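/- Let $n\in\mathbb{N}$, let $\mathcal{P}\subset\mathbb{R}^n$ be open, let $g:\mathcal{P}\times\mathbb{R}\to\mathbb{R}$, and consider the equation $$-\phi''+g(\mu,\phi)=0. \qquad (*)$$ For $L_0>0$ let $L^2_{per}([0,L_0])$ be the space of real $L_0$-periodic functions that are square integrable over a period, let $H^2_{per}([0,L_0])$ be the Sobolev space of those $u\in L^2_{per}([0,L_0])$ with weak derivatives $u',u''\in L^2_{per}([0,L_0])$, with norm $(\|u\|^2+\|u'\|^2+\|u''\|^2)^{1/2}$, and let $H^2_{per,e}([0,L_0])$ be its subspace of even functions. **Theorem.** Fix $\mu_0\in\mathcal{P}$ and $L_0>0$, and let $\phi_{\mu_0}\in C^2(\mathbb{R})$ be an even $L_0$-periodic solution of $(*)$ with $\mu=\mu_0$. Let $k\in\{1,2,\dots\}\cup\{\infty\}$ and assume that $g$ is of class $C^k$, jointly in $(\mu,\phi)$, on an open set $U\subset\mathcal{P}\times\mathbb{R}$ that contains $\{\mu_0\}\times\phi_{\mu_0}(\mathbb{R})$. Let $$\mathcal{L}_{\mu_0}y=-y''+\frac{\partial g}{\partial\phi}(\mu_0,\phi_{\mu_0})\,y,\qquad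 y\in H^2_{per}([0,L_0]),$$ be the linearized operator in $L^2_{per}([0,L_0])$. If $\ker(\mathcal{L}_{\mu_0})=\mathrm{span}\{\phi_{\mu_0}'\}$, then there are an open neighborhood $\mathcal{O}\subset\mathcal{P}$ of $\mu_0$ and a family $$\mu\in\mathcal{O}\mapsto\psi_\mu\in H^2_{per,e}([0,L_0])$$ such that every $\psi_\mu$ is an even $L_0$-periodic (classical, $C^2$) solution of $(*)$, and the map $\mu\mapsto\psi_\mu$ is of class $C^k$ from $\mathcal{O}$ to $H^2_{per,e}([0,L_0])$ (so it is smooth if $g$ is smooth on $U$). In addition, $\psi_{\mu_0}=\phi_{\mu_0}$, and $\psi_\mu\to\phi_{\mu_0}$ as $\mu\to\mu_0$, both in $H^2_{per}([0,L_0])$ and uniformly on $[0,L_0]$. -/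

import Mathlib

open MeasureTheory Set Filter Topology
open scoped ContDiff

namespace PeriodicWave

/-- `L²_per([0,L])`: real square integrable functions on the circle `ℝ / Lℤ`,
with the measure of total mass `L`. -/
abbrev L2Per (L : ℝ) [Fact (0 < L)] : Type := Lp ℝ 2 (volume : Measure (AddCircle L))

/-- `v` is the weak (periodic distributional) derivative of `u`:
`∫₀ᴸ u θ' = - ∫₀ᴸ v θ` for every smooth `L`-periodic test function `θ`. -/
def IsWeakDeriv {L : ℝ} [Fact (0 < L)] (u v : L2Per L) : Prop :=
  ∀ θ : ℝ → ℝ, ContDiff ℝ ∞ θ → Function.Periodic θ L →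
    ∫ x in (0 : ℝ)..L, u (x : AddCircle L) * deriv θ x
      = - ∫ x in (0 : ℝ)..L, v (x : AddCircle L) * θ x

/-- Pulling back an almost everywhere property from the circle to the line. -/
theorem ae_line_of_ae_circle {L : ℝ} [hL : Fact (0 < L)] {p : AddCircle L → Prop}
    (h : ∀ᵐ t : AddCircle L, p t) :
    ∀ᵐ x : ℝ ∂(volume.restrict (Ioc 0 L)), p (x : AddCircle L) := by
  have := (AddCircle.measurePreserving_mk L 0).quasiMeasurePreserving.ae h
  simpa using this

theorem intervalIntegrable_mul {L : ℝ} [hL : Fact (0 < L)] (u : L2Per L) {θ : ℝ → ℝ}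
    (hθ : Continuous θ) :
    IntervalIntegrable (fun x : ℝ => u (x : AddCircle L) * θ x) volume 0 L := by
  have hu : Integrable (fun t => u t) (volume : Measure (AddCircle L)) :=
    (Lp.memLp u).integrable (by norm_num)
  have h1 : IntegrableOn (fun x : ℝ => u (x : AddCircle L)) (Ioc 0 L) := by
    have := (AddCircle.measurePreserving_mk L 0).integrable_comp_of_integrable hu
    simpa [IntegrableOn, Function.comp_def] using this
  have h2 : IntervalIntegrable (fun x : ℝ => u (x : AddCircle L)) volume 0 L :=
    (intervalIntegrable_iff_integrableOn_Ioc_of_le hL.out.le).2 h1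
  exact h2.mul_continuousOn hθ.continuousOn

theorem integral_add_mul {L : ℝ} [hL : Fact (0 < L)] (u v : L2Per L) {θ : ℝ → ℝ}
    (hθ : Continuous θ) :
    ∫ x in (0 : ℝ)..L, (u + v : L2Per L) (x : AddCircle L) * θ x
      = (∫ x in (0 : ℝ)..L, u (x : AddCircle L) * θ x)
        + ∫ x in (0 : ℝ)..L, v (x : AddCircle L) * θ x := by
  rw [← intervalIntegral.integral_add (intervalIntegrable_mul u hθ) (intervalIntegrable_mul v hθ)]
  rw [intervalIntegral.integral_of_le hL.out.le, intervalIntegral.integral_of_le hL.out.le]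
  apply integral_congr_ae
  filter_upwards [ae_line_of_ae_circle (Lp.coeFn_add u v)] with x hx
  rw [hx, Pi.add_apply, add_mul]

theorem integral_smul_mul {L : ℝ} [hL : Fact (0 < L)] (c : ℝ) (u : L2Per L) (θ : ℝ → ℝ) :
    ∫ x in (0 : ℝ)..L, (c • u : L2Per L) (x : AddCircle L) * θ x
      = c * ∫ x in (0 : ℝ)..L, u (x : AddCircle L) * θ x := by
  rw [← intervalIntegral.integral_const_mul]
  rw [intervalIntegral.integral_of_le hL.out.le, intervalIntegral.integral_of_le hL.out.le]
  apply integral_congr_ae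
  filter_upwards [ae_line_of_ae_circle (Lp.coeFn_smul c u)] with x hx
  rw [hx, Pi.smul_apply, smul_eq_mul, mul_assoc]

theorem IsWeakDeriv.add {L : ℝ} [Fact (0 < L)] {u v u' v' : L2Per L}
    (h : IsWeakDeriv u u') (h' : IsWeakDeriv v v') : IsWeakDeriv (u + v) (u' + v') := by
  intro θ hθ hp
  rw [integral_add_mul _ _ (hθ.continuous_deriv (by simp)), integral_add_mul _ _ hθ.continuous,
    h θ hθ hp, h' θ hθ hp]
  ring

theorem IsWeakDeriv.smul {L : ℝ} [Fact (0 < L)] (c : ℝ) {u u' : L2Per L}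
    (h : IsWeakDeriv u u') : IsWeakDeriv (c • u) (c • u') := by
  intro θ hθ hp
  rw [integral_smul_mul, integral_smul_mul, h θ hθ hp]
  ring

/-- The periodic Sobolev space `H²_per([0,L])`. An element is written as the triple
`(u, u', u'')` of a function and its two (uniquely determined) weak derivatives in `L²_per`,
and the norm is `(‖u‖² + ‖u'‖² + ‖u''‖²)^(1/2)` with `L²` norms. -/
def H2Per (L : ℝ) [Fact (0 < L)] : Submodule ℝ (PiLp 2 (fun _ : Fin 3 => L2Per L)) where
  carrier := {U | IsWeakDeriv (U 0) (U 1) ∧ IsWeakDeriv (U 1) (U 2)}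
  add_mem' h h' := ⟨h.1.add h'.1, h.2.add h'.2⟩
  zero_mem' := by
    have h0 : IsWeakDeriv (0 : L2Per L) 0 := by
      intro θ _ _
      have h := integral_smul_mul (L := L) 0 0 θ
      have h' := integral_smul_mul (L := L) 0 0 (deriv θ)
      rw [smul_zero, zero_mul] at h h'
      rw [h, h', neg_zero]
    exact ⟨h0, h0⟩
  smul_mem' c _ h := ⟨h.1.smul c, h.2.smul c⟩

/-- The subspace `H²_per,e([0,L])` of even functions, with the norm of `H²_per([0,L])`. -/
def H2PerEven (L : ℝ) [Fact (0 < L)] : Submodule ℝ (H2Per L) where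
  carrier := {U | ∀ᵐ t : AddCircle L, U.1 0 (-t) = U.1 0 t}
  add_mem' := by
    intro U V hU hV
    have h := Lp.coeFn_add (U.1 0) (V.1 0)
    have h' := (Measure.measurePreserving_neg
      (volume : Measure (AddCircle L))).quasiMeasurePreserving.ae h
    change ∀ᵐ t : AddCircle L, (U.1 0 + V.1 0 : L2Per L) (-t) = (U.1 0 + V.1 0 : L2Per L) t
    filter_upwards [h, h', hU, hV] with t h1 h2 h3 h4
    rw [h1, h2, Pi.add_apply, Pi.add_apply, h3, h4]
  zero_mem' := by
    have h := Lp.coeFn_zero ℝ 2 (volume : Measure (AddCircle L))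
    have h' := (Measure.measurePreserving_neg
      (volume : Measure (AddCircle L))).quasiMeasurePreserving.ae h
    change ∀ᵐ t : AddCircle L, (0 : L2Per L) (-t) = (0 : L2Per L) t
    filter_upwards [h, h'] with t h1 h2
    rw [h1, h2, Pi.zero_apply, Pi.zero_apply]
  smul_mem' := by
    intro c U hU
    have h := Lp.coeFn_smul c (U.1 0)
    have h' := (Measure.measurePreserving_neg
      (volume : Measure (AddCircle L))).quasiMeasurePreserving.ae h
    change ∀ᵐ t : AddCircle L, (c • U.1 0 : L2Per L) (-t) = (c • U.1 0 : L2Per L) t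
    filter_upwards [h, h', hU] with t h1 h2 h3
    rw [h1, h2, Pi.smul_apply, Pi.smul_apply, h3]

/-- The element `U` of `H²_per([0,L])` is the class of the function `f` on the line. -/
def Represents {L : ℝ} [Fact (0 < L)] (U : H2Per L) (f : ℝ → ℝ) : Prop :=
  ∀ᵐ x : ℝ, U.1 0 (x : AddCircle L) = f x

/-- Hill's operator `y ↦ -y'' + q y` with domain `H²_per([0,L])`, read on the line. -/
noncomputable def hillOperator {L : ℝ} [Fact (0 < L)] (q : ℝ → ℝ) (y : H2Per L) : ℝ → ℝ :=
  fun x => - y.1 2 (x : AddCircle L) + q x * y.1 0 (x : AddCircle L)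

/-- The kernel of Hill's operator in `H²_per([0,L])`. -/
def hillKernel (L : ℝ) [Fact (0 < L)] (q : ℝ → ℝ) : Set (H2Per L) :=
  {y | ∀ᵐ x : ℝ, hillOperator q y x = 0}

/-- `φ` is an even `L`-periodic classical solution of `-φ'' + g(μ, φ) = 0`. -/
structure IsEvenPeriodicSolution {E : Type*} (g : E → ℝ → ℝ) (L : ℝ) (μ : E) (φ : ℝ → ℝ) :
    Prop where
  contDiff : ContDiff ℝ 2 φ
  equation : ∀ x, - deriv (deriv φ) x + g μ (φ x) = 0
  periodic : Function.Periodic φ L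
  even : Function.Even φ

end PeriodicWave

/-! The differential equation is traded for an integral equation on `C(AddCircle L, ℝ)`. Let `W f`
be the double primitive of the even part of `f`, with the mean subtracted, normalized by `W f (0) =
0`. Even periodic solutions of `y'' = g(μ, y)` are the zeros of `F(μ, y) = y - y(0) - W f + mean f`
with `f = g(μ, y)`. At the point `0` the equation reduces to `mean f = 0`; then `y = y(0) + W f` is
even, so `f` is even, and two differentiations give `y'' = f`. The solvability condition and the
symmetry are thus built into a single equation.

In the sup norm the superposition operator is as smooth as `g` (`contDiffOn_superposition`), and
only values of `g` near the graph of `φ₀` matter. The operators `W`, `mean` and evaluation at `0`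
are compact, so the derivative of `F` in `y` is the identity minus a compact operator. An element
`h` of its kernel is even and solves `h'' = q h` with `q = ∂g/∂φ(μ₀, φ₀)`. By hypothesis `h = c
φ₀'`, which is odd, so `h = 0` (`eq_zero_of_linearized_integral_equation`). The Fredholm alternative
gives invertibility, and the implicit function theorem gives a `C^k` branch in the sup norm.

The `H²` element is a bounded linear image of the pair `(y, g(μ, y))` (`sobolevMap`), so it is `C^k`
in `μ` as well. -/

namespace PeriodicWave

/-! ### Smoothness of superposition operators in the sup norm -/

section Superposition

set_option linter.unusedSectionVars false

variable {K E G : Type} [TopologicalSpace K] [CompactSpace K]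
  [NormedAddCommGroup E] [NormedSpace ℝ E] [NormedAddCommGroup G] [NormedSpace ℝ G]

open Classical in
/-- The superposition (Nemytskii) operator `Φ ↦ g ∘ Φ` on continuous functions, with value `0`
where the composition is not continuous. -/
noncomputable def superposition (g : E → G) (Φ : C(K, E)) : C(K, G) :=
  if h : Continuous (g ∘ Φ) then ⟨g ∘ Φ, h⟩ else 0

/-- For `Φ` with values in `U` the default value `0` never occurs; the regularity statements below
are confined to this open set. -/
theorem superposition_apply {g : E → G} {U : Set E} (hU : IsOpen U) (hg : ContinuousOn g U)
    {Φ : C(K, E)} (hΦ : ∀ x, Φ x ∈ U) (x : K) : superposition g Φ x = g (Φ x) := by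
  have h : Continuous (g ∘ Φ) := by
    rw [continuous_iff_continuousAt]
    exact fun y => (hg.continuousAt (hU.mem_nhds (hΦ y))).comp Φ.continuous.continuousAt
  simp [superposition, h]

theorem isOpen_setOf_forall_apply_mem {U : Set E} (hU : IsOpen U) :
    IsOpen {Φ : C(K, E) | ∀ x, Φ x ∈ U} := by
  simpa [MapsTo] using! ContinuousMap.isOpen_setOfPred_mapsTo (X := K) isCompact_univ hU

/-- A continuous function on an open set is uniformly continuous near the range of a continuous
function on a compact space. -/
theorem exists_uniform_modulus {g : E → G} {U : Set E} (hU : IsOpen U) (hg : ContinuousOn g U)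
    {Φ : C(K, E)} (hΦ : ∀ x, Φ x ∈ U) {ε : ℝ} (hε : 0 < ε) :
    ∃ δ > 0, ∀ x, ∀ a, dist a (Φ x) < δ → a ∈ U ∧ dist (g a) (g (Φ x)) < ε := by
  have hK : IsCompact (range Φ) := isCompact_range Φ.continuous
  have hsub : range Φ ⊆ U := by rintro _ ⟨x, rfl⟩; exact hΦ x
  obtain ⟨δ₁, hδ₁, h₁⟩ := hK.exists_thickening_subset_open hU hsub
  have h₂ := hK.uniformContinuousAt_of_continuousAt g
    (fun a ha => hg.continuousAt (hU.mem_nhds (hsub ha))) (Metric.dist_mem_uniformity hε)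
  obtain ⟨δ₂, hδ₂, h₂⟩ := Metric.mem_uniformity_dist.1 h₂
  refine ⟨min δ₁ δ₂, lt_min hδ₁ hδ₂, fun x a ha => ⟨h₁ ?_, ?_⟩⟩
  · exact Metric.mem_thickening_iff.2 ⟨Φ x, mem_range_self x, ha.trans_le (min_le_left _ _)⟩
  · have := h₂ (a := Φ x) (b := a) (by rw [dist_comm]; exact ha.trans_le (min_le_right _ _))
      (mem_range_self x)
    rw [dist_comm]; exact this

theorem continuousOn_superposition {g : E → G} {U : Set E} (hU : IsOpen U)
    (hg : ContinuousOn g U) :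
    ContinuousOn (superposition g) {Φ : C(K, E) | ∀ x, Φ x ∈ U} := by
  intro Φ hΦ
  refine ContinuousAt.continuousWithinAt (Metric.continuousAt_iff.2 fun ε hε => ?_)
  obtain ⟨δ, hδ, h⟩ := exists_uniform_modulus hU hg hΦ hε
  refine ⟨δ, hδ, fun {Θ} hΘ => ?_⟩
  have hx : ∀ x, dist (Θ x) (Φ x) < δ := fun x =>
    (ContinuousMap.dist_apply_le_dist x).trans_lt hΘ
  rw [ContinuousMap.dist_lt_iff hε]
  intro x
  rw [superposition_apply hU hg (fun x => (h x _ (hx x)).1), superposition_apply hU hg hΦ]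
  exact (h x _ (hx x)).2

/-- Pointwise application of a continuous field of operators to a continuous function. -/
noncomputable def pointwiseApply : C(K, E →L[ℝ] G) →L[ℝ] C(K, E) →L[ℝ] C(K, G) :=
  LinearMap.mkContinuous₂
    (LinearMap.mk₂ ℝ (fun (A : C(K, E →L[ℝ] G)) (h : C(K, E)) =>
      (⟨fun x => A x (h x), A.continuous.clm_apply h.continuous⟩ : C(K, G)))
      (fun _ _ _ => by ext; simp) (fun _ _ _ => by ext; simp)
      (fun _ _ _ => by ext; simp) (fun _ _ _ => by ext; simp)) 1 (by
    intro A h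
    rw [ContinuousMap.norm_le _ (by positivity), one_mul]
    intro x
    exact ((A x).le_opNorm _).trans (mul_le_mul (A.norm_coe_le_norm x) (h.norm_coe_le_norm x)
      (norm_nonneg _) (norm_nonneg A)))

@[simp]
theorem pointwiseApply_apply (A : C(K, E →L[ℝ] G)) (h : C(K, E)) (x : K) :
    pointwiseApply A h x = A x (h x) := rfl

/-- The mean value inequality on the balls around `Φ x` bounds the remainder; a radius `δ` uniform
in `x`, from compactness of the range of `Φ`, makes the bound hold in the sup norm. -/
theorem hasFDerivAt_superposition {g : E → G} {U : Set E} (hU : IsOpen U)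
    (hg : ContDiffOn ℝ 1 g U) {Φ : C(K, E)} (hΦ : ∀ x, Φ x ∈ U) :
    HasFDerivAt (superposition g) (pointwiseApply (superposition (fderiv ℝ g) Φ)) Φ := by
  have hd : DifferentiableOn ℝ g U := hg.differentiableOn one_ne_zero
  have hc : ContinuousOn (fderiv ℝ g) U := hg.continuousOn_fderiv_of_isOpen hU le_rfl
  rw [hasFDerivAt_iff_isLittleO_nhds_zero, Asymptotics.isLittleO_iff]
  intro ε hε
  obtain ⟨δ, hδ, h⟩ := exists_uniform_modulus hU hc hΦ hε
  filter_upwards [Metric.ball_mem_nhds (0 : C(K, E)) hδ] with Θ hΘ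
  have hΘ' : ‖Θ‖ < δ := by simpa using hΘ
  have hx : ∀ x, dist (Φ x + Θ x) (Φ x) < δ := fun x => by
    rw [dist_self_add_left]; exact (Θ.norm_coe_le_norm x).trans_lt hΘ'
  have hmem : ∀ x, (Φ + Θ) x ∈ U := fun x => (h x _ (hx x)).1
  rw [ContinuousMap.norm_le _ (by positivity)]
  intro x
  have key := (convex_ball (Φ x) δ).norm_image_sub_le_of_norm_fderiv_le' (𝕜 := ℝ) (f := g)
    (φ := fderiv ℝ g (Φ x)) (C := ε)
    (fun a ha => (hd a (h x a ha).1).differentiableAt (hU.mem_nhds (h x a ha).1))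
    (fun a ha => by rw [← dist_eq_norm]; exact (h x a ha).2.le)
    (Metric.mem_ball_self hδ) (hx x)
  simp only [ContinuousMap.sub_apply, pointwiseApply_apply]
  rw [superposition_apply hU hd.continuousOn hmem, superposition_apply hU hd.continuousOn hΦ,
    superposition_apply hU hc hΦ]
  rw [add_sub_cancel_left] at key
  exact key.trans (mul_le_mul_of_nonneg_left (Θ.norm_coe_le_norm x) hε.le)

/-- The derivative is a fixed bounded linear map applied to the superposition operator of `fderiv ℝ
g`, so one order is gained by induction. The target `G` must vary, since `fderiv ℝ g` takes values
in `E →L[ℝ] G`. -/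
theorem contDiffOn_superposition_nat (m : ℕ) : ∀ {G : Type} [NormedAddCommGroup G]
    [NormedSpace ℝ G] {g : E → G} {U : Set E}, IsOpen U → ContDiffOn ℝ m g U →
    ContDiffOn ℝ m (superposition g) {Φ : C(K, E) | ∀ x, Φ x ∈ U} := by
  induction m with
  | zero =>
    intro G _ _ g U hU hg
    rw [Nat.cast_zero, contDiffOn_zero] at *
    exact continuousOn_superposition hU hg
  | succ m ih =>
    intro G _ _ g U hU hg
    have hg1 : ContDiffOn ℝ 1 g U := hg.of_le (by exact_mod_cast Nat.le_add_left 1 m)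
    rw [Nat.cast_add, Nat.cast_one] at *
    rw [contDiffOn_succ_iff_fderiv_of_isOpen (isOpen_setOf_forall_apply_mem hU)]
    rw [contDiffOn_succ_iff_fderiv_of_isOpen hU] at hg
    refine ⟨fun Φ hΦ => (hasFDerivAt_superposition hU hg1 hΦ).differentiableAt
      |>.differentiableWithinAt, by simp, ?_⟩
    refine ContDiffOn.congr (f := fun Φ => pointwiseApply (superposition (fderiv ℝ g) Φ)) ?_
      fun Φ hΦ => (hasFDerivAt_superposition hU hg1 hΦ).fderiv
    exact (pointwiseApply (K := K)).contDiff.comp_contDiffOn (ih hU hg.2.2)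

theorem contDiffOn_superposition {k : ℕ∞} {g : E → G} {U : Set E} (hU : IsOpen U)
    (hg : ContDiffOn ℝ k g U) :
    ContDiffOn ℝ k (superposition g) {Φ : C(K, E) | ∀ x, Φ x ∈ U} :=
  contDiffOn_iff_forall_nat_le.2 fun m hm =>
    contDiffOn_superposition_nat m hU (hg.of_le (by exact_mod_cast hm))

end Superposition

/-! ### Implicit function theorem on an open set -/

/-- The implicit function theorem, with a solution of class `C^k` on an open set. -/
theorem exists_contDiffOn_implicit {E X Z : Type*} [NormedAddCommGroup E] [NormedSpace ℝ E]
    [CompleteSpace E] [NormedAddCommGroup X] [NormedSpace ℝ X] [CompleteSpace X]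
    [NormedAddCommGroup Z] [NormedSpace ℝ Z] [CompleteSpace Z] {k : WithTop ℕ∞} (hk : 1 ≤ k)
    {F : E × X → Z} {Ω : Set (E × X)} (hΩ : IsOpen Ω) (hF : ContDiffOn ℝ k F Ω) {a : E} {b : X}
    (hab : (a, b) ∈ Ω) (h0 : F (a, b) = 0)
    (hinv : (fderiv ℝ F (a, b) ∘L .inr ℝ E X).IsInvertible) :
    ∃ (O : Set E) (y : E → X), IsOpen O ∧ a ∈ O ∧ y a = b ∧ ContDiffOn ℝ k y O ∧
      ∀ μ ∈ O, (μ, y μ) ∈ Ω ∧ F (μ, y μ) = 0 := by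
  have hk0 : k ≠ 0 := (zero_lt_one.trans_le hk).ne'
  have hat : ∀ u ∈ Ω, ContDiffAt ℝ k F u := fun u hu => (hF u hu).contDiffAt (hΩ.mem_nhds hu)
  set y := (hat _ hab).implicitFunction hk0 hinv with hy
  have hya : y a = b := (hat _ hab).implicitFunction_apply_self hk0 hinv
  have hsol : ∀ᶠ μ in 𝓝 a, F (μ, y μ) = 0 := by
    simpa [h0] using (hat _ hab).eventually_apply_implicitFunction hk0 hinv
  have hy1 : ContDiffAt ℝ 1 y a := ((hat _ hab).contDiffAt_implicitFunction hk0 hinv).of_le hk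
  have hyc : Tendsto (fun μ => (μ, y μ)) (𝓝 a) (𝓝 (a, b)) := by
    have := hy1.continuousAt.tendsto
    rw [hya] at this
    exact tendsto_id.prodMk_nhds this
  have hfd : ContinuousAt (fderiv ℝ F) (a, b) :=
    (hF.continuousOn_fderiv_of_isOpen hΩ hk).continuousAt (hΩ.mem_nhds hab)
  have hinv' : ∀ᶠ u in 𝓝 (a, b), (fderiv ℝ F u ∘L .inr ℝ E X).IsInvertible := by
    have : ContinuousAt (fun u => fderiv ℝ F u ∘L .inr ℝ E X) (a, b) :=
      hfd.clm_comp continuousAt_const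
    exact this.eventually_mem (ContinuousLinearEquiv.isOpen.mem_nhds hinv)
  have hev : ∀ᶠ μ in 𝓝 a, ((μ, y μ) ∈ Ω ∧ F (μ, y μ) = 0) ∧
      (fderiv ℝ F (μ, y μ) ∘L .inr ℝ E X).IsInvertible ∧ ContDiffAt ℝ 1 y μ :=
    ((hyc.eventually_mem (hΩ.mem_nhds hab)).and hsol).and
      ((hyc.eventually hinv').and (hy1.eventually (by simp)))
  refine ⟨interior {μ | _}, y, isOpen_interior, mem_interior_iff_mem_nhds.2 hev, hya, ?_,
    fun μ hμ => (interior_subset hμ).1⟩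
  intro μ hμ
  obtain ⟨⟨hμΩ, hμ0⟩, hμi, hμy⟩ := interior_subset hμ
  refine ContDiffAt.contDiffWithinAt ?_
  -- For `k = ∞`, being `C^k` at `a` alone provides no common neighborhood for all orders. The
  -- theorem is therefore applied again at `(μ, y μ)`, and local uniqueness identifies the new
  -- branch with `y` near `μ`.
  refine ((hat _ hμΩ).contDiffAt_implicitFunction hk0 hμi).congr_of_eventuallyEq ?_
  have hμc : Tendsto (fun ν => (ν, y ν)) (𝓝 μ) (𝓝 (μ, y μ)) :=
    tendsto_id.prodMk_nhds hμy.continuousAt.tendsto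
  filter_upwards [hμc.eventually ((hat _ hμΩ).eventually_apply_eq_iff_implicitFunction hk0 hμi),
    mem_interior_iff_mem_nhds.1 hμ] with ν hν hν'
  exact (hν.1 (hν'.1.2.trans hμ0.symm)).symm

/-! ### Mean, primitives and compact operators on the circle -/

section Circle

set_option linter.unusedSectionVars false

variable {L : ℝ} [hL : Fact (0 < L)]

/-- The mean value of a continuous function on the circle. -/
noncomputable def circleMean : C(AddCircle L, ℝ) →L[ℝ] ℝ :=
  LinearMap.mkContinuous
    { toFun := fun f => L⁻¹ * ∫ t, f t
      map_add' := fun f g => by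
        have hi : ∀ f : C(AddCircle L, ℝ), Integrable f :=
          fun f => f.continuous.integrable_of_hasCompactSupport (HasCompactSupport.of_compactSpace f)
        simp only [ContinuousMap.add_apply]
        rw [integral_add (hi f) (hi g), mul_add]
      map_smul' := fun c f => by
        simp only [ContinuousMap.smul_apply, smul_eq_mul, RingHom.id_apply]
        rw [integral_const_mul]; ring } 1 (by
    intro f
    have hb : ‖∫ t, f t‖ ≤ ‖f‖ * (volume : Measure (AddCircle L)).real univ :=
      norm_integral_le_of_norm_le_const (Eventually.of_forall f.norm_coe_le_norm)
    rw [measureReal_def, AddCircle.measure_univ, ENNReal.toReal_ofReal hL.out.le] at hb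
    change ‖L⁻¹ * ∫ t, f t‖ ≤ 1 * ‖f‖
    rw [norm_mul, norm_inv, Real.norm_of_nonneg hL.out.le, inv_mul_le_iff₀ hL.out]
    linarith)

theorem circleMean_apply (f : C(AddCircle L, ℝ)) : circleMean f = L⁻¹ * ∫ t, f t := rfl

theorem abs_circleMean_le (f : C(AddCircle L, ℝ)) : |circleMean f| ≤ ‖f‖ := by
  have := (circleMean (L := L)).le_of_opNorm_le
    (LinearMap.mkContinuous_norm_le _ zero_le_one _) f
  simpa using this

theorem circleMean_eq_zero_of_odd {f : C(AddCircle L, ℝ)} (hf : ∀ t, f (-t) = -f t) :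
    circleMean f = 0 := by
  have h := integral_neg_eq_self (fun t => f t) (volume : Measure (AddCircle L))
  simp only [hf, integral_neg] at h
  rw [circleMean_apply, show ∫ t, f t = 0 by linarith, mul_zero]

/-- The projection onto the constants given by the mean value. -/
noncomputable def meanOp : C(AddCircle L, ℝ) →L[ℝ] C(AddCircle L, ℝ) :=
  ContinuousLinearMap.toSpanSingleton ℝ 1 ∘L circleMean

@[simp]
theorem meanOp_apply (f : C(AddCircle L, ℝ)) (t : AddCircle L) : meanOp f t = circleMean f := by
  simp [meanOp, ContinuousLinearMap.toSpanSingleton_apply]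

/-- The projection onto the constants given by the value at `0`. -/
noncomputable def valueOp : C(AddCircle L, ℝ) →L[ℝ] C(AddCircle L, ℝ) :=
  ContinuousLinearMap.toSpanSingleton ℝ 1 ∘L ContinuousMap.evalCLM ℝ (0 : AddCircle L)

@[simp]
theorem valueOp_apply (f : C(AddCircle L, ℝ)) (t : AddCircle L) : valueOp f t = f 0 := by
  simp [valueOp, ContinuousLinearMap.toSpanSingleton_apply]

theorem isCompactOperator_toSpanSingleton_comp {X Y : Type*} [NormedAddCommGroup X]
    [NormedSpace ℝ X] [NormedAddCommGroup Y] [NormedSpace ℝ Y] (l : X →L[ℝ] ℝ) (y : Y) :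
    IsCompactOperator (ContinuousLinearMap.toSpanSingleton ℝ y ∘L l) := by
  have hl : IsCompactOperator l := isCompactOperator_of_locallyCompactSpace_dom l
  exact hl.clm_comp (ContinuousLinearMap.toSpanSingleton ℝ y)

theorem isCompactOperator_meanOp : IsCompactOperator (meanOp (L := L)) :=
  isCompactOperator_toSpanSingleton_comp _ _

theorem isCompactOperator_valueOp : IsCompactOperator (valueOp (L := L)) :=
  isCompactOperator_toSpanSingleton_comp _ _

theorem continuous_comp_coe (f : C(AddCircle L, ℝ)) : Continuous fun x : ℝ => f (x : AddCircle L) :=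
  f.continuous.comp (AddCircle.continuous_mk' L)

theorem intervalIntegrable_sub_circleMean (f : C(AddCircle L, ℝ)) (a b : ℝ) :
    IntervalIntegrable (fun x : ℝ => f (x : AddCircle L) - circleMean f) volume a b :=
  ((continuous_comp_coe f).sub continuous_const).intervalIntegrable _ _

/-- Without its mean the integrand has zero integral over a period, which lets the primitive descend
to the circle. -/
theorem periodic_integral_sub_circleMean (f : C(AddCircle L, ℝ)) :
    Function.Periodic (fun x : ℝ => ∫ s in (0 : ℝ)..x, (f (s : AddCircle L) - circleMean f)) L := by
  intro x
  dsimp only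
  rw [← intervalIntegral.integral_add_adjacent_intervals (b := x)
    (intervalIntegrable_sub_circleMean f _ _) (intervalIntegrable_sub_circleMean f _ _),
    add_eq_left, intervalIntegral.integral_sub ((continuous_comp_coe f).intervalIntegrable _ _)
      intervalIntegrable_const, AddCircle.intervalIntegral_preimage L x (fun t => f t),
    intervalIntegral.integral_const, circleMean_apply]
  have := hL.out.ne'
  simp; field_simp; simp

theorem abs_integral_sub_circleMean_le (f : C(AddCircle L, ℝ)) (a b : ℝ) :
    |∫ s in a..b, (f (s : AddCircle L) - circleMean f)| ≤ 2 * ‖f‖ * |b - a| := by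
  rw [← Real.norm_eq_abs]
  refine intervalIntegral.norm_integral_le_of_norm_le_const fun x _ => ?_
  have h1 : ‖f (x : AddCircle L)‖ ≤ ‖f‖ := f.norm_coe_le_norm _
  have h2 := abs_circleMean_le f
  calc ‖f (x : AddCircle L) - circleMean f‖ ≤ ‖f (x : AddCircle L)‖ + ‖circleMean f‖ := norm_sub_le _ _
    _ ≤ 2 * ‖f‖ := by rw [Real.norm_eq_abs (circleMean f)]; linarith

/-- The primitive, vanishing at `0`, of a continuous function on the circle minus its mean, as a
continuous function. -/
noncomputable def primitiveMap (f : C(AddCircle L, ℝ)) : C(AddCircle L, ℝ) where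
  toFun := (periodic_integral_sub_circleMean f).lift
  continuous_toFun := Continuous.quotient_lift (intervalIntegral.continuous_primitive
    (fun a b => intervalIntegrable_sub_circleMean f a b) 0) _

theorem primitiveMap_coe (f : C(AddCircle L, ℝ)) (x : ℝ) :
    primitiveMap f (x : AddCircle L) = ∫ s in (0 : ℝ)..x, (f (s : AddCircle L) - circleMean f) := rfl

/-- The primitive, vanishing at `0`, of a continuous function on the circle minus its mean. -/
noncomputable def primitive : C(AddCircle L, ℝ) →L[ℝ] C(AddCircle L, ℝ) :=
  LinearMap.mkContinuous
    { toFun := primitiveMap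
      map_add' := fun f g => by
        ext t
        obtain ⟨x, -, rfl⟩ := AddCircle.eq_coe_Ico t
        rw [ContinuousMap.add_apply, primitiveMap_coe, primitiveMap_coe, primitiveMap_coe,
          ← intervalIntegral.integral_add (intervalIntegrable_sub_circleMean f _ _)
          (intervalIntegrable_sub_circleMean g _ _)]
        congr 1; ext s
        simp only [map_add, ContinuousMap.add_apply]; ring
      map_smul' := fun c f => by
        ext t
        obtain ⟨x, -, rfl⟩ := AddCircle.eq_coe_Ico t
        rw [RingHom.id_apply, ContinuousMap.smul_apply, primitiveMap_coe, primitiveMap_coe,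
          smul_eq_mul, ← intervalIntegral.integral_const_mul]
        congr 1; ext s
        simp only [map_smul, ContinuousMap.smul_apply, smul_eq_mul]; ring } (2 * L) (by
    intro f
    have hL0 := hL.out
    rw [ContinuousMap.norm_le _ (by positivity)]
    intro t
    obtain ⟨x, hx, rfl⟩ := AddCircle.eq_coe_Ico t
    refine (abs_integral_sub_circleMean_le f 0 x).trans ?_
    rw [sub_zero, abs_of_nonneg hx.1]
    nlinarith [hx.2, norm_nonneg f])

theorem primitive_coe (f : C(AddCircle L, ℝ)) (x : ℝ) :
    primitive f (x : AddCircle L) = ∫ s in (0 : ℝ)..x, (f (s : AddCircle L) - circleMean f) := rfl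

@[simp]
theorem primitive_zero (f : C(AddCircle L, ℝ)) : primitive f 0 = 0 := by
  have := primitive_coe f 0
  rwa [intervalIntegral.integral_same, AddCircle.coe_zero] at this

theorem hasDerivAt_primitive (f : C(AddCircle L, ℝ)) (x : ℝ) :
    HasDerivAt (fun x : ℝ => primitive f (x : AddCircle L))
      (f (x : AddCircle L) - circleMean f) x := by
  simp only [primitive_coe]
  exact ((continuous_comp_coe f).sub continuous_const).integral_hasStrictDerivAt 0 x |>.hasDerivAt

theorem primitive_neg_of_even {f : C(AddCircle L, ℝ)} (hf : ∀ t, f (-t) = f t) (t : AddCircle L) :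
    primitive f (-t) = -primitive f t := by
  obtain ⟨x, -, rfl⟩ := AddCircle.eq_coe_Ico t
  rw [← AddCircle.coe_neg, primitive_coe, primitive_coe]
  have := intervalIntegral.integral_comp_neg (a := 0) (b := x)
    (fun s : ℝ => f (s : AddCircle L) - circleMean f)
  simp only [AddCircle.coe_neg, hf, neg_zero] at this
  rw [this, ← intervalIntegral.integral_symm]

theorem primitive_neg_of_odd {f : C(AddCircle L, ℝ)} (hf : ∀ t, f (-t) = -f t) (t : AddCircle L) :
    primitive f (-t) = primitive f t := by
  obtain ⟨x, -, rfl⟩ := AddCircle.eq_coe_Ico t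
  rw [← AddCircle.coe_neg, primitive_coe, primitive_coe]
  have := intervalIntegral.integral_comp_neg (a := 0) (b := x)
    (fun s : ℝ => f (s : AddCircle L) - circleMean f)
  simp only [AddCircle.coe_neg, hf, neg_zero, circleMean_eq_zero_of_odd hf, sub_zero,
    intervalIntegral.integral_neg] at this ⊢
  rw [intervalIntegral.integral_symm, ← this, neg_neg]

theorem abs_primitive_sub_le (f : C(AddCircle L, ℝ)) (s t : AddCircle L) :
    |primitive f s - primitive f t| ≤ 2 * ‖f‖ * ‖s - t‖ := by
  obtain ⟨y, -, rfl⟩ := AddCircle.eq_coe_Ico t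
  obtain ⟨z, -, rfl⟩ := AddCircle.eq_coe_Ico s
  rw [← AddCircle.coe_sub, AddCircle.norm_eq]
  -- Shifting `z` by `m` periods makes its distance to `y` on the line equal to the distance on the
  -- circle.
  set m : ℤ := round (L⁻¹ * (z - y))
  have hz : (z : AddCircle L) = ((z - m * L : ℝ) : AddCircle L) := by
    rw [AddCircle.coe_sub, ← zsmul_eq_mul, AddCircle.coe_zsmul, AddCircle.coe_period, smul_zero,
      sub_zero]
  rw [hz, primitive_coe, primitive_coe, intervalIntegral.integral_interval_sub_left
    (intervalIntegrable_sub_circleMean f _ _) (intervalIntegrable_sub_circleMean f _ _)]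
  refine (abs_integral_sub_circleMean_le f _ _).trans_eq ?_
  congr 2; ring

/-- Arzelà–Ascoli, transported from bounded continuous functions by the isometry with `C(α, ℝ)`. -/
theorem isCompact_setOf_bounded_lipschitz {α : Type*} [SeminormedAddCommGroup α] [CompactSpace α]
    (C : ℝ) :
    IsCompact {f : C(α, ℝ) | (∀ t, |f t| ≤ C) ∧ ∀ s t, |f s - f t| ≤ C * ‖s - t‖} := by
  set A : Set (BoundedContinuousFunction α ℝ) :=
    {f | (∀ t, |f t| ≤ C) ∧ ∀ s t, |f s - f t| ≤ C * ‖s - t‖}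
  have hev : ∀ t : α, Continuous fun f : BoundedContinuousFunction α ℝ => f t :=
    fun t => continuous_eval_const t
  have hA : IsCompact A := by
    refine BoundedContinuousFunction.arzela_ascoli₂ (Icc (-C) C) isCompact_Icc A ?_
      (fun f x hf => abs_le.1 (hf.1 x)) ?_
    · simp only [A, ofPred_and, ofPred_forall]
      exact (isClosed_iInter fun t => isClosed_le (hev t).abs continuous_const).inter
        (isClosed_iInter fun s => isClosed_iInter fun t =>
          isClosed_le ((hev s).sub (hev t)).abs continuous_const)
    · refine LipschitzWith.uniformEquicontinuous _ C.toNNReal (fun f => ?_) |>.equicontinuous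
      refine LipschitzWith.of_dist_le_mul fun s t => ?_
      rw [Real.dist_eq, dist_eq_norm]
      exact (f.2.2 s t).trans (mul_le_mul_of_nonneg_right (Real.le_coe_toNNReal C) (norm_nonneg _))
  have hI : {f : C(α, ℝ) | (∀ t, |f t| ≤ C) ∧ ∀ s t, |f s - f t| ≤ C * ‖s - t‖} =
      (ContinuousMap.linearIsometryBoundedOfCompact α ℝ ℝ).symm '' A := by
    ext f
    constructor
    · intro hf
      exact ⟨ContinuousMap.linearIsometryBoundedOfCompact α ℝ ℝ f, hf, by simp⟩
    · rintro ⟨f, hf, rfl⟩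
      exact hf
  rw [hI]
  exact hA.image (ContinuousMap.linearIsometryBoundedOfCompact α ℝ ℝ).symm.continuous

theorem isCompactOperator_primitive : IsCompactOperator (primitive (L := L)) := by
  rw [isCompactOperator_iff_exists_mem_nhds_image_subset_compact]
  refine ⟨Metric.closedBall 0 1, Metric.closedBall_mem_nhds _ one_pos, _,
    -- On the unit ball, `2` bounds the Lipschitz constant and the operator norm bounds the values;
    -- the sum serves for both.
    isCompact_setOf_bounded_lipschitz (2 + ‖primitive (L := L)‖), ?_⟩
  rintro _ ⟨f, hf, rfl⟩
  have hf' : ‖f‖ ≤ 1 := by simpa using hf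
  refine ⟨fun t => ?_, fun s t => (abs_primitive_sub_le f s t).trans ?_⟩
  · have h1 : |primitive f t| ≤ ‖primitive f‖ := (primitive f).norm_coe_le_norm t
    have h2 := (primitive (L := L)).le_opNorm f
    nlinarith [norm_nonneg (primitive (L := L)), norm_nonneg f]
  · refine mul_le_mul_of_nonneg_right ?_ (norm_nonneg _)
    linarith [norm_nonneg (primitive (L := L))]

/-- The even part of a continuous function on the circle. -/
noncomputable def evenPart : C(AddCircle L, ℝ) →L[ℝ] C(AddCircle L, ℝ) :=
  LinearMap.mkContinuous
    { toFun := fun f => ⟨fun t => (f t + f (-t)) / 2, by fun_prop⟩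
      map_add' := fun f g => by ext t; simp; ring
      map_smul' := fun c f => by ext t; simp; ring } 1 (by
    intro f
    rw [ContinuousMap.norm_le _ (by positivity), one_mul]
    intro t
    have h1 := f.norm_coe_le_norm t
    have h2 := f.norm_coe_le_norm (-t)
    rw [Real.norm_eq_abs, abs_le] at *
    constructor <;> simp <;> linarith)

theorem evenPart_apply (f : C(AddCircle L, ℝ)) (t : AddCircle L) :
    evenPart f t = (f t + f (-t)) / 2 := rfl

theorem evenPart_neg (f : C(AddCircle L, ℝ)) (t : AddCircle L) :
    evenPart f (-t) = evenPart f t := by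
  rw [evenPart_apply, evenPart_apply, neg_neg, add_comm]

theorem evenPart_of_even {f : C(AddCircle L, ℝ)} (hf : ∀ t, f (-t) = f t) : evenPart f = f := by
  ext t
  rw [evenPart_apply, hf]; ring

/-- The even solution operator of `w'' = f - mean f`, `w 0 = 0`, applied to the even part of `f`. -/
noncomputable def solutionOp : C(AddCircle L, ℝ) →L[ℝ] C(AddCircle L, ℝ) :=
  primitive ∘L primitive ∘L evenPart

theorem solutionOp_apply (f : C(AddCircle L, ℝ)) :
    solutionOp f = primitive (primitive (evenPart f)) := rfl

theorem isCompactOperator_solutionOp : IsCompactOperator (solutionOp (L := L)) :=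
  isCompactOperator_primitive.comp_clm (primitive ∘L evenPart)

theorem solutionOp_neg (f : C(AddCircle L, ℝ)) (t : AddCircle L) :
    solutionOp f (-t) = solutionOp f t :=
  primitive_neg_of_odd (primitive_neg_of_even (evenPart_neg f)) t

/-- The inner primitive is odd, so the outer one subtracts no mean and `solutionOp f` has exactly
the inner primitive as its derivative. -/
theorem circleMean_primitive_evenPart (f : C(AddCircle L, ℝ)) :
    circleMean (primitive (evenPart f)) = 0 :=
  circleMean_eq_zero_of_odd (primitive_neg_of_even (evenPart_neg f))

theorem hasDerivAt_solutionOp (f : C(AddCircle L, ℝ)) (x : ℝ) :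
    HasDerivAt (fun x : ℝ => solutionOp f (x : AddCircle L))
      (primitive (evenPart f) (x : AddCircle L)) x := by
  have := hasDerivAt_primitive (primitive (evenPart f)) x
  rwa [circleMean_primitive_evenPart, sub_zero] at this

/-- Fredholm alternative: for a compact operator the number `1` is an eigenvalue or a regular value.
-/
theorem isUnit_one_sub_of_isCompactOperator {X : Type*} [NormedAddCommGroup X] [NormedSpace ℝ X]
    [CompleteSpace X] {T : X →L[ℝ] X} (hT : IsCompactOperator T) (hinj : ∀ x, T x = x → x = 0) :
    IsUnit (1 - T) := by
  rcases hT.hasEigenvalue_or_mem_resolventSet one_ne_zero with h | h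
  · obtain ⟨x, hx⟩ := h.exists_hasEigenvector
    exact absurd (hinj x (by simpa using hx.apply_eq_smul)) hx.2
  · simpa [spectrum.mem_resolventSet_iff] using h

end Circle

/-! ### From continuous functions to the Sobolev space -/

section Sobolev

variable {L : ℝ} [hL : Fact (0 < L)]

/-- The class in `L²_per` of a continuous function. -/
noncomputable abbrev toL2Per : C(AddCircle L, ℝ) →L[ℝ] L2Per L :=
  ContinuousMap.toLp 2 (volume : Measure (AddCircle L)) ℝ

theorem ae_real_of_ae_circle {p : AddCircle L → Prop} (h : ∀ᵐ t : AddCircle L, p t) :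
    ∀ᵐ x : ℝ, p (x : AddCircle L) := by
  have h1 : ∀ m : ℤ, ∀ᵐ x : ℝ ∂(volume.restrict (Ioc (m • L) ((m + 1) • L))),
      p (x : AddCircle L) := fun m => by
    have := (AddCircle.measurePreserving_mk L (m • L)).quasiMeasurePreserving.ae h
    rwa [add_smul, one_smul]
  have h2 := (ae_restrict_iUnion_iff (μ := (volume : Measure ℝ))
    (fun m : ℤ => Ioc (m • L) ((m + 1) • L)) (fun x => p (x : AddCircle L))).2 h1
  rwa [iUnion_Ioc_zsmul hL.out, Measure.restrict_univ] at h2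

theorem toL2Per_ae_real (f : C(AddCircle L, ℝ)) :
    ∀ᵐ x : ℝ, toL2Per f (x : AddCircle L) = f (x : AddCircle L) :=
  ae_real_of_ae_circle (ContinuousMap.coeFn_toLp (p := 2) (𝕜 := ℝ) volume f)

theorem integral_toL2Per_mul (f : C(AddCircle L, ℝ)) (θ : ℝ → ℝ) :
    ∫ x in (0 : ℝ)..L, toL2Per f (x : AddCircle L) * θ x
      = ∫ x in (0 : ℝ)..L, f (x : AddCircle L) * θ x := by
  refine intervalIntegral.integral_congr_ae ?_
  filter_upwards [toL2Per_ae_real f] with x hx _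
  rw [hx]

/-- Integration by parts; the boundary terms cancel by periodicity. -/
theorem isWeakDeriv_toL2Per {u v : C(AddCircle L, ℝ)}
    (h : ∀ x : ℝ, HasDerivAt (fun x : ℝ => u (x : AddCircle L)) (v (x : AddCircle L)) x) :
    IsWeakDeriv (toL2Per u) (toL2Per v) := by
  intro θ hθ hp
  rw [integral_toL2Per_mul, integral_toL2Per_mul]
  have hθd : ∀ x, HasDerivAt θ (deriv θ x) x := fun x =>
    (hθ.differentiable (by simp) x).hasDerivAt
  rw [intervalIntegral.integral_mul_deriv_eq_deriv_mul (fun x _ => h x) (fun x _ => hθd x)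
    ((continuous_comp_coe v).intervalIntegrable _ _)
    ((hθ.continuous_deriv (by simp)).intervalIntegrable _ _)]
  have h1 := hp 0
  rw [zero_add] at h1
  rw [h1, AddCircle.coe_period, AddCircle.coe_zero]
  ring

/-- The continuous linear map sending `(y, f)` to the element of `H²_per,e` with value `y 0` at `0`
and second derivative `f - mean f`, where `f` is replaced by its even part. -/
noncomputable def sobolevMap :
    C(AddCircle L, ℝ) × C(AddCircle L, ℝ) →L[ℝ] H2PerEven L :=
  let T : C(AddCircle L, ℝ) × C(AddCircle L, ℝ) →L[ℝ] PiLp 2 (fun _ : Fin 3 => L2Per L) :=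
    (PiLp.continuousLinearEquiv 2 ℝ (fun _ : Fin 3 => L2Per L)).symm.toContinuousLinearMap ∘L
      ContinuousLinearMap.pi ![toL2Per ∘L (valueOp.coprod solutionOp),
        toL2Per ∘L primitive ∘L evenPart ∘L .snd ℝ _ _,
        toL2Per ∘L (evenPart - meanOp ∘L evenPart) ∘L .snd ℝ _ _]
  (T.codRestrict (H2Per L) (fun p => by
    refine ⟨isWeakDeriv_toL2Per fun x => ?_, isWeakDeriv_toL2Per fun x => ?_⟩
    · simpa using! (hasDerivAt_solutionOp p.2 x).const_add (p.1 0)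
    · simpa using! hasDerivAt_primitive (evenPart p.2) x)).codRestrict (H2PerEven L) (fun p => by
    have h := ContinuousMap.coeFn_toLp (p := 2) (𝕜 := ℝ) (volume : Measure (AddCircle L))
      (valueOp.coprod solutionOp p)
    have h' := (Measure.measurePreserving_neg
      (volume : Measure (AddCircle L))).quasiMeasurePreserving.ae h
    change ∀ᵐ t : AddCircle L, toL2Per (valueOp.coprod solutionOp p) (-t) =
      toL2Per (valueOp.coprod solutionOp p) t
    filter_upwards [h, h'] with t h1 h2
    rw [h1, h2]
    simp [solutionOp_neg])

theorem sobolevMap_zero (p : C(AddCircle L, ℝ) × C(AddCircle L, ℝ)) :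
    (sobolevMap p : H2Per L).1 0 = toL2Per (valueOp p.1 + solutionOp p.2) := rfl

theorem sobolevMap_two (p : C(AddCircle L, ℝ) × C(AddCircle L, ℝ)) :
    (sobolevMap p : H2Per L).1 2 = toL2Per (evenPart p.2 - meanOp (evenPart p.2)) := rfl

end Sobolev

/-! ### The integral equation and its equivalence with the differential equation -/

section Reduction

variable {L : ℝ} [hL : Fact (0 < L)]

/-- The linear part `f ↦ W f - mean f` of the integral equation. -/
noncomputable def integralOp : C(AddCircle L, ℝ) →L[ℝ] C(AddCircle L, ℝ) :=
  solutionOp - meanOp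

theorem isCompactOperator_integralOp : IsCompactOperator (integralOp (L := L)) :=
  isCompactOperator_solutionOp.sub isCompactOperator_meanOp

@[simp]
theorem integralOp_apply (f : C(AddCircle L, ℝ)) (t : AddCircle L) :
    integralOp f t = solutionOp f t - circleMean f := by
  simp [integralOp]

/-- The solutions of the integral equation are even and their right-hand side has mean zero. -/
theorem integral_equation_consequences {y f : C(AddCircle L, ℝ)}
    (h : y - valueOp y - integralOp f = 0) :
    circleMean f = 0 ∧ y = valueOp y + solutionOp f ∧ ∀ t, y (-t) = y t := by
  have hm : circleMean f = 0 := by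
    -- At `0` both `y - y(0)` and `solutionOp f` vanish, leaving only the mean.
    have := DFunLike.congr_fun h 0
    simpa [solutionOp_apply] using this
  have hy : y = valueOp y + solutionOp f := by
    rw [sub_sub, sub_eq_zero] at h
    conv_lhs => rw [h]
    ext t
    simp [hm]
  refine ⟨hm, hy, fun t => ?_⟩
  have h1 := DFunLike.congr_fun hy (-t)
  have h2 := DFunLike.congr_fun hy t
  rw [ContinuousMap.add_apply, valueOp_apply] at h1 h2
  rw [h1, h2, solutionOp_neg]

/-- The solutions of the integral equation are classical solutions of `y'' = f`. -/
theorem contDiff_two_of_integral_equation {y f : C(AddCircle L, ℝ)}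
    (hm : circleMean f = 0) (hy : y = valueOp y + solutionOp f) (hf : ∀ t, f (-t) = f t) :
    ContDiff ℝ 2 (fun x : ℝ => y (x : AddCircle L)) ∧
      ∀ x, deriv (deriv fun x : ℝ => y (x : AddCircle L)) x = f (x : AddCircle L) := by
  have h1 : ∀ x : ℝ, HasDerivAt (fun x : ℝ => y (x : AddCircle L)) (primitive f (x : AddCircle L)) x := by
    intro x
    have := (hasDerivAt_solutionOp f x).const_add (y 0)
    rw [evenPart_of_even hf] at this
    refine this.congr_of_eventuallyEq (Eventually.of_forall fun z => ?_)
    have := DFunLike.congr_fun hy (z : AddCircle L)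
    simpa using this
  have h2 : ∀ x : ℝ, HasDerivAt (fun x : ℝ => primitive f (x : AddCircle L)) (f (x : AddCircle L)) x := by
    intro x
    simpa [hm] using hasDerivAt_primitive f x
  have hd1 : deriv (fun x : ℝ => y (x : AddCircle L)) = fun x : ℝ => primitive f (x : AddCircle L) :=
    funext fun x => (h1 x).deriv
  have hd2 : deriv (fun x : ℝ => primitive f (x : AddCircle L)) = fun x : ℝ => f (x : AddCircle L) :=
    funext fun x => (h2 x).deriv
  refine ⟨?_, fun x => by rw [hd1, hd2]⟩
  rw [show (2 : WithTop ℕ∞) = 1 + 1 by norm_num, contDiff_succ_iff_deriv, hd1,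
    contDiff_one_iff_deriv, hd2]
  exact ⟨fun x => (h1 x).differentiableAt, by simp, fun x => (h2 x).differentiableAt,
    continuous_comp_coe f⟩

theorem deriv_neg_of_even {φ : ℝ → ℝ} (hφ : Function.Even φ) (x : ℝ) :
    deriv φ (-x) = -deriv φ x := by
  have h : (fun x => φ (-x)) = φ := funext hφ
  have := deriv_comp_neg φ x
  rw [h] at this
  linarith

theorem deriv_neg_of_odd {φ : ℝ → ℝ} (hφ : ∀ x, φ (-x) = -φ x) (x : ℝ) :
    deriv φ (-x) = deriv φ x := by
  have h : (fun x => φ (-x)) = fun x => -φ x := funext hφ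
  have := deriv_comp_neg φ x
  rw [h, deriv.fun_neg] at this
  linarith

theorem deriv_periodic {φ : ℝ → ℝ} {c : ℝ} (hφ : Function.Periodic φ c) :
    Function.Periodic (deriv φ) c := by
  intro x
  have h : (fun x => φ (x + c)) = φ := funext hφ
  rw [← deriv_comp_add_const, h]

/-- Even periodic classical solutions of `φ'' = f` solve the integral equation. -/
theorem integral_equation_of_contDiff_two {φ : ℝ → ℝ} (hφ : ContDiff ℝ 2 φ)
    (hp : Function.Periodic φ L) (he : Function.Even φ) {y f : C(AddCircle L, ℝ)}
    (hy : ∀ x : ℝ, y (x : AddCircle L) = φ x)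
    (hf : ∀ x : ℝ, f (x : AddCircle L) = deriv (deriv φ) x) :
    y - valueOp y - integralOp f = 0 ∧ ∀ t, f (-t) = f t := by
  have hodd := deriv_neg_of_even he
  have hfe : ∀ t, f (-t) = f t := by
    intro t
    obtain ⟨x, -, rfl⟩ := AddCircle.eq_coe_Ico t
    rw [← AddCircle.coe_neg, hf, hf, deriv_neg_of_odd hodd]
  have hd : ∀ x, HasDerivAt φ (deriv φ x) x := fun x =>
    (hφ.differentiable (by norm_num) x).hasDerivAt
  have hφ' : ContDiff ℝ 1 (deriv φ) := by
    rw [show (2 : WithTop ℕ∞) = 1 + 1 by norm_num, contDiff_succ_iff_deriv] at hφ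
    exact hφ.2.2
  have hdd : ∀ x : ℝ, HasDerivAt (deriv φ) (f (x : AddCircle L)) x := fun x => by
    rw [hf]; exact (hφ'.differentiable (by norm_num) x).hasDerivAt
  have hm : circleMean f = 0 := by
    rw [circleMean_apply, ← AddCircle.intervalIntegral_preimage L 0 (fun t => f t),
      intervalIntegral.integral_eq_sub_of_hasDerivAt (fun x _ => hdd x)
        ((continuous_comp_coe f).intervalIntegrable _ _), deriv_periodic hp 0, sub_self, mul_zero]
  have h0 : deriv φ 0 = 0 := by
    have := hodd 0
    rw [neg_zero] at this
    linarith
  have hprim : ∀ x : ℝ, primitive f (x : AddCircle L) = deriv φ x := by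
    intro x
    rw [primitive_coe, hm]
    simp only [sub_zero]
    rw [intervalIntegral.integral_eq_sub_of_hasDerivAt (fun x _ => hdd x)
      ((continuous_comp_coe f).intervalIntegrable _ _), h0, sub_zero]
  have hsol : ∀ x : ℝ, solutionOp f (x : AddCircle L) = φ x - φ 0 := by
    intro x
    have hmp := circleMean_primitive_evenPart f
    rw [evenPart_of_even hfe] at hmp
    rw [solutionOp_apply, evenPart_of_even hfe, primitive_coe, hmp]
    simp only [sub_zero, hprim]
    exact intervalIntegral.integral_eq_sub_of_hasDerivAt (fun x _ => hd x)
      (hφ'.continuous.intervalIntegrable _ _)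
  refine ⟨?_, hfe⟩
  ext t
  obtain ⟨x, -, rfl⟩ := AddCircle.eq_coe_Ico t
  have hy0 := hy 0
  rw [AddCircle.coe_zero] at hy0
  simp [hy, hy0, hsol, hm]

/-- An even solution of the linearized integral equation vanishes if the kernel of Hill's operator
consists of odd functions. -/
theorem eq_zero_of_linearized_integral_equation {q φ : ℝ → ℝ} (hφ : ContDiff ℝ 2 φ)
    (he : Function.Even φ)
    (hker : hillKernel L q = {y | ∃ c : ℝ, Represents y (fun x => c * deriv φ x)})
    {h f : C(AddCircle L, ℝ)} (hq : ∀ x : ℝ, f (x : AddCircle L) = q x * h (x : AddCircle L))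
    (hqe : ∀ x, q (-x) = q x) (heq : h - valueOp h - integralOp f = 0) : h = 0 := by
  obtain ⟨hm, hh, heven⟩ := integral_equation_consequences heq
  have hfe : ∀ t, f (-t) = f t := by
    intro t
    obtain ⟨x, -, rfl⟩ := AddCircle.eq_coe_Ico t
    rw [← AddCircle.coe_neg, hq, hq, hqe, AddCircle.coe_neg, heven]
  have hM : meanOp f = 0 := by ext t; simp [hm]
  have h0 : (sobolevMap (h, f) : H2Per L).1 0 = toL2Per h := by
    rw [sobolevMap_zero]; exact congrArg toL2Per hh.symm
  have h2 : (sobolevMap (h, f) : H2Per L).1 2 = toL2Per f := by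
    rw [sobolevMap_two, evenPart_of_even hfe, hM, sub_zero]
  have hmem : (sobolevMap (h, f) : H2Per L) ∈ hillKernel L q := by
    change ∀ᵐ x : ℝ, hillOperator q _ x = 0
    filter_upwards [toL2Per_ae_real h, toL2Per_ae_real f] with x hx hx'
    rw [hillOperator, h0, h2, hx, hx', hq]
    ring
  rw [hker] at hmem
  obtain ⟨c, hc⟩ := hmem
  have hae : (fun x : ℝ => h (x : AddCircle L)) =ᵐ[volume] fun x => c * deriv φ x := by
    filter_upwards [hc, toL2Per_ae_real h] with x hx hx'
    rw [← hx, h0, hx']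
  have hall := (Continuous.ae_eq_iff_eq volume (continuous_comp_coe h)
    ((hφ.continuous_deriv (by norm_num)).const_mul c)).1 hae
  ext t
  obtain ⟨x, -, rfl⟩ := AddCircle.eq_coe_Ico t
  have e1 := congrFun hall x
  have e2 := congrFun hall (-x)
  rw [deriv_neg_of_even he, AddCircle.coe_neg, heven] at e2
  rw [ContinuousMap.zero_apply]
  linarith

/-! ### The nonlinear operator, its linearization and the branch of solutions -/

variable {E : Type} [NormedAddCommGroup E] [NormedSpace ℝ E]

/-- A parameter and a function on the circle, as a function into the product. -/
noncomputable def pairMap : E × C(AddCircle L, ℝ) →L[ℝ] C(AddCircle L, E × ℝ) :=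
  LinearMap.mkContinuous
    { toFun := fun p => ⟨fun t => (p.1, p.2 t), by fun_prop⟩
      map_add' := fun _ _ => by ext <;> simp
      map_smul' := fun _ _ => by ext <;> simp } 1 (by
    intro p
    rw [ContinuousMap.norm_le _ (by positivity), one_mul]
    exact fun t => max_le_max le_rfl (p.2.norm_coe_le_norm t))

@[simp]
theorem pairMap_apply (p : E × C(AddCircle L, ℝ)) (t : AddCircle L) :
    pairMap p t = (p.1, p.2 t) := rfl

/-- The nonlinear operator `(μ, y) ↦ y - y(0) - W g(μ, y) + mean g(μ, y)`, with `W` the even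
solution operator of `w'' = f - mean f`, `w(0) = 0`. -/
noncomputable def waveOperator (G : E × ℝ → ℝ) (p : E × C(AddCircle L, ℝ)) : C(AddCircle L, ℝ) :=
  p.2 - valueOp p.2 - integralOp (superposition G (pairMap p))

/-- The pairs `(μ, y)` for which the graph of `y` at `μ` lies in `U`. -/
def graphDomain (L : ℝ) [Fact (0 < L)] (U : Set (E × ℝ)) : Set (E × C(AddCircle L, ℝ)) :=
  {p | ∀ t, (p.1, p.2 t) ∈ U}

theorem isOpen_graphDomain {U : Set (E × ℝ)} (hU : IsOpen U) : IsOpen (graphDomain L U) :=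
  (isOpen_setOf_forall_apply_mem hU).preimage (pairMap (E := E) (L := L)).continuous

theorem contDiffOn_superposition_pairMap {k : ℕ∞} {G : E × ℝ → ℝ} {U : Set (E × ℝ)}
    (hU : IsOpen U) (hG : ContDiffOn ℝ k G U) :
    ContDiffOn ℝ k (fun p => superposition G (pairMap p)) (graphDomain L U) :=
  (contDiffOn_superposition hU hG).comp (pairMap (E := E) (L := L)).contDiff.contDiffOn fun _ hp => hp

theorem contDiffOn_waveOperator {k : ℕ∞} {G : E × ℝ → ℝ} {U : Set (E × ℝ)}
    (hU : IsOpen U) (hG : ContDiffOn ℝ k G U) :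
    ContDiffOn ℝ k (waveOperator G) (graphDomain L U) := by
  have h1 : ContDiff ℝ k fun p : E × C(AddCircle L, ℝ) => p.2 - valueOp p.2 :=
    contDiff_snd.sub ((valueOp (L := L)).contDiff.comp contDiff_snd)
  exact h1.contDiffOn.sub
    ((integralOp (L := L)).contDiff.comp_contDiffOn (contDiffOn_superposition_pairMap hU hG))

/-- The linear operator `h ↦ DG(μ, y) (0, h)`. -/
noncomputable def linearizedSuperposition (G : E × ℝ → ℝ) (p : E × C(AddCircle L, ℝ)) :
    C(AddCircle L, ℝ) →L[ℝ] C(AddCircle L, ℝ) :=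
  pointwiseApply (superposition (fderiv ℝ G) (pairMap p)) ∘L pairMap ∘L .inr ℝ E _

theorem fderiv_waveOperator_comp_inr {G : E × ℝ → ℝ} {U : Set (E × ℝ)} (hU : IsOpen U)
    (hG : ContDiffOn ℝ 1 G U) {p : E × C(AddCircle L, ℝ)} (hp : p ∈ graphDomain L U) :
    fderiv ℝ (waveOperator G) p ∘L .inr ℝ E _ =
      1 - (valueOp + integralOp ∘L linearizedSuperposition G p) := by
  have h1 := (hasFDerivAt_superposition hU hG (Φ := pairMap p) hp).comp p
    (pairMap (E := E) (L := L)).hasFDerivAt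
  have h2 : HasFDerivAt (waveOperator G) _ p :=
    (hasFDerivAt_snd.sub (valueOp.hasFDerivAt.comp p hasFDerivAt_snd)).sub
      (integralOp.hasFDerivAt.comp p h1)
  rw [h2.fderiv]
  ext h t
  simp [linearizedSuperposition]
  ring

/-- The chain rule along `s ↦ (μ, s)` turns the joint derivative into the partial one, the potential
in Hill's operator. -/
theorem linearizedSuperposition_apply {g : E → ℝ → ℝ} {U : Set (E × ℝ)} (hU : IsOpen U)
    (hG : ContDiffOn ℝ 1 (fun p : E × ℝ => g p.1 p.2) U) {p : E × C(AddCircle L, ℝ)}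
    (hp : p ∈ graphDomain L U) (h : C(AddCircle L, ℝ)) (t : AddCircle L) :
    linearizedSuperposition (fun p : E × ℝ => g p.1 p.2) p h t = deriv (g p.1) (p.2 t) * h t := by
  have hd : HasFDerivAt (fun p : E × ℝ => g p.1 p.2)
      (fderiv ℝ (fun p : E × ℝ => g p.1 p.2) (p.1, p.2 t)) (p.1, p.2 t) :=
    ((hG _ (hp t)).contDiffAt (hU.mem_nhds (hp t))).differentiableAt one_ne_zero |>.hasFDerivAt
  have hl : HasDerivAt (fun s : ℝ => (p.1, s)) ((0 : E), (1 : ℝ)) (p.2 t) :=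
    (hasDerivAt_const _ _).prodMk (hasDerivAt_id _)
  have hg' : deriv (g p.1) (p.2 t) =
      fderiv ℝ (fun p : E × ℝ => g p.1 p.2) (p.1, p.2 t) (0, 1) :=
    (hd.comp_hasDerivAt (p.2 t) hl).deriv
  change superposition (fderiv ℝ _) (pairMap p) t (0, h t) = _
  rw [superposition_apply hU (hG.continuousOn_fderiv_of_isOpen hU le_rfl) (Φ := pairMap p) hp, hg',
    pairMap_apply, show ((0 : E), h t) = h t • ((0 : E), (1 : ℝ)) by simp, map_smul, smul_eq_mul,
    mul_comm]

/-- Boundedness of `T` suffices, as `B ∘L T` inherits compactness from `B`; here `T` is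
multiplication by the potential. -/
theorem isInvertible_one_sub_of_isCompactOperator {X : Type*} [NormedAddCommGroup X]
    [NormedSpace ℝ X] [CompleteSpace X] {A B : X →L[ℝ] X} (T : X →L[ℝ] X)
    (hA : IsCompactOperator A) (hB : IsCompactOperator B)
    (hinj : ∀ x, x - A x - B (T x) = 0 → x = 0) : (1 - (A + B ∘L T)).IsInvertible := by
  have hc : IsCompactOperator (A + B ∘L T : X →L[ℝ] X) := hA.add (hB.comp_clm T)
  obtain ⟨u, hu⟩ := isUnit_one_sub_of_isCompactOperator hc fun x hx => hinj x (by
    rw [add_apply, ContinuousLinearMap.comp_apply] at hx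
    rw [sub_sub, hx, sub_self])
  exact ⟨ContinuousLinearEquiv.unitsEquiv ℝ _ u, by rw [← hu]; rfl⟩

theorem isInvertible_fderiv_waveOperator {g : E → ℝ → ℝ} {U : Set (E × ℝ)} (hU : IsOpen U)
    (hG : ContDiffOn ℝ 1 (fun p : E × ℝ => g p.1 p.2) U) {μ : E} {y : C(AddCircle L, ℝ)}
    (hp : (μ, y) ∈ graphDomain L U) {φ : ℝ → ℝ} (hφ : ContDiff ℝ 2 φ) (he : Function.Even φ)
    (hy : ∀ x : ℝ, y (x : AddCircle L) = φ x)
    (hker : hillKernel L (fun x => deriv (g μ) (φ x)) =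
      {y | ∃ c : ℝ, Represents y (fun x => c * deriv φ x)}) :
    (fderiv ℝ (waveOperator fun p : E × ℝ => g p.1 p.2) (μ, y) ∘L
      .inr ℝ E C(AddCircle L, ℝ)).IsInvertible := by
  rw [fderiv_waveOperator_comp_inr hU hG hp]
  refine isInvertible_one_sub_of_isCompactOperator _ isCompactOperator_valueOp
    isCompactOperator_integralOp fun h hh => ?_
  refine eq_zero_of_linearized_integral_equation hφ he hker (fun x => ?_)
    (fun x => by rw [he x]) hh
  rw [linearizedSuperposition_apply hU hG hp, hy]


theorem contDiff_sobolevMap {k : WithTop ℕ∞} : ContDiff ℝ k (sobolevMap (L := L)) :=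
  @ContinuousLinearMap.contDiff ℝ (C(AddCircle L, ℝ) × C(AddCircle L, ℝ)) (H2PerEven L) _ _ _
    (Submodule.normedAddCommGroup _) (Submodule.normedSpace _) k sobolevMap

/-- The second derivative is read off from `G(μ, y μ)`, already `C^k` in the sup norm, so passing to
`H²` costs no smoothness in `μ`. -/
theorem contDiffOn_sobolevMap {k : ℕ∞} {G : E × ℝ → ℝ} {U : Set (E × ℝ)} (hU : IsOpen U)
    (hG : ContDiffOn ℝ k G U) {O : Set E} {y : E → C(AddCircle L, ℝ)} (hy : ContDiffOn ℝ k y O)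
    (hyO : ∀ μ ∈ O, (μ, y μ) ∈ graphDomain L U) :
    ContDiffOn ℝ k (fun μ => sobolevMap (y μ, superposition G (pairMap (μ, y μ)))) O := by
  have h1 : ContDiffOn ℝ k (fun μ => superposition G (pairMap (μ, y μ))) O :=
    (contDiffOn_superposition_pairMap hU hG).comp (contDiffOn_id.prodMk hy) hyO
  exact contDiff_sobolevMap.comp_contDiffOn (hy.prodMk h1)

theorem exists_contDiffOn_zero_waveOperator [CompleteSpace E] {G : E × ℝ → ℝ} {k : ℕ∞}
    (hk : 1 ≤ (k : WithTop ℕ∞)) {U : Set (E × ℝ)} (hU : IsOpen U) (hG : ContDiffOn ℝ k G U)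
    {μ₀ : E} {y₀ : C(AddCircle L, ℝ)} (hdom : (μ₀, y₀) ∈ graphDomain L U)
    (h0 : waveOperator G (μ₀, y₀) = 0)
    (hinv : (fderiv ℝ (waveOperator G) (μ₀, y₀) ∘L
      .inr ℝ E C(AddCircle L, ℝ)).IsInvertible) :
    ∃ (O : Set E) (y : E → C(AddCircle L, ℝ)), IsOpen O ∧ μ₀ ∈ O ∧ y μ₀ = y₀ ∧
      ContDiffOn ℝ k y O ∧ ∀ μ ∈ O, (μ, y μ) ∈ graphDomain L U ∧ waveOperator G (μ, y μ) = 0 := by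
  have h1 := contDiffOn_waveOperator (L := L) hU hG
  have h2 := isOpen_graphDomain (L := L) hU
  generalize waveOperator (L := L) G = F at *
  generalize graphDomain L U = Ω at *
  exact exists_contDiffOn_implicit hk h2 h1 hdom h0 hinv

/-- Persistence of even periodic waves, for parameters in a Banach space. -/
theorem exists_even_periodic_branch [CompleteSpace E] {P : Set E} {g : E → ℝ → ℝ}
    {k : ℕ∞} (hk : 1 ≤ k) {L₀ : ℝ} [Fact (0 < L₀)] {μ₀ : E} {φ₀ : ℝ → ℝ}
    (hφ₀ : IsEvenPeriodicSolution g L₀ μ₀ φ₀)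
    {U : Set (E × ℝ)} (hU : IsOpen U) (hUP : U ⊆ P ×ˢ Set.univ)
    (hφU : ∀ x, (μ₀, φ₀ x) ∈ U)
    (hg : ContDiffOn ℝ (k : WithTop ℕ∞) (fun p => g p.1 p.2) U)
    (hker : hillKernel L₀ (fun x => deriv (g μ₀) (φ₀ x))
      = {y | ∃ c : ℝ, Represents y (fun x => c * deriv φ₀ x)}) :
    ∃ O : Set E, IsOpen O ∧ μ₀ ∈ O ∧ O ⊆ P ∧
      ∃ (ψ : E → ℝ → ℝ) (Ψ : E → H2PerEven L₀),
        (∀ μ ∈ O, IsEvenPeriodicSolution g L₀ μ (ψ μ)) ∧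
        (∀ μ ∈ O, Represents (Ψ μ : H2Per L₀) (ψ μ)) ∧
        ContDiffOn ℝ (k : WithTop ℕ∞) Ψ O ∧
        ψ μ₀ = φ₀ ∧
        Tendsto (fun μ => (Ψ μ : H2Per L₀)) (𝓝 μ₀)
          (𝓝 (Ψ μ₀ : H2Per L₀)) ∧
        TendstoUniformlyOn ψ φ₀ (𝓝 μ₀) (Set.Icc 0 L₀) := by
  have hk' : (1 : WithTop ℕ∞) ≤ k := by exact_mod_cast hk
  set G : E × ℝ → ℝ := fun p => g p.1 p.2 with hG
  have hg1 : ContDiffOn ℝ 1 G U := hg.of_le hk'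
  let y₀ : C(AddCircle L₀, ℝ) :=
    ⟨hφ₀.periodic.lift, Continuous.quotient_lift hφ₀.contDiff.continuous _⟩
  have hy₀ : ∀ x : ℝ, y₀ (x : AddCircle L₀) = φ₀ x := fun x => rfl
  clear_value y₀
  have hdom : (μ₀, y₀) ∈ graphDomain L₀ U := by
    intro t
    obtain ⟨x, -, rfl⟩ := AddCircle.eq_coe_Ico t
    change (μ₀, y₀ (x : AddCircle L₀)) ∈ U
    rw [hy₀]
    exact hφU x
  have hN : ∀ {p : E × C(AddCircle L₀, ℝ)}, p ∈ graphDomain L₀ U →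
      ∀ t, superposition G (pairMap p) t = g p.1 (p.2 t) := fun {p} hp t =>
    superposition_apply hU hg.continuousOn (Φ := pairMap p) hp t
  have h0 : waveOperator G (μ₀, y₀) = 0 :=
    (integral_equation_of_contDiff_two hφ₀.contDiff hφ₀.periodic hφ₀.even hy₀ fun x => by
      rw [hN hdom]
      have := hφ₀.equation x
      rw [hy₀]
      linarith).1
  have hinv := isInvertible_fderiv_waveOperator hU hg1 hdom hφ₀.contDiff hφ₀.even hy₀ hker
  obtain ⟨O, y, hO, hμO, hyμ, hyk, hyO⟩ := exists_contDiffOn_zero_waveOperator hk' hU hg hdom h0 hinv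
  have hsol : ∀ μ ∈ O, circleMean (superposition G (pairMap (μ, y μ))) = 0 ∧
      y μ = valueOp (y μ) + solutionOp (superposition G (pairMap (μ, y μ))) ∧
      ∀ t, y μ (-t) = y μ t := fun μ hμ => integral_equation_consequences (hyO μ hμ).2
  have hΨ := contDiffOn_sobolevMap hU hg hyk fun μ hμ => (hyO μ hμ).1
  refine ⟨O, hO, hμO, fun μ hμ => (hUP ((hyO μ hμ).1 0)).1, fun μ x => y μ (x : AddCircle L₀),
    fun μ => sobolevMap (y μ, superposition G (pairMap (μ, y μ))), fun μ hμ => ?_, fun μ hμ => ?_,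
    hΨ, ?_, ?_, ?_⟩
  · obtain ⟨hm, hy, he⟩ := hsol μ hμ
    -- Evenness of `y μ` passes to `g(μ, y μ)`, so the even part taken in `solutionOp` changes
    -- nothing and the equation itself is recovered.
    obtain ⟨hc, hd⟩ := contDiff_two_of_integral_equation hm hy fun t => by
      rw [hN (hyO μ hμ).1, hN (hyO μ hμ).1, he]
    refine ⟨hc, fun x => ?_, fun x => ?_, fun x => ?_⟩
    · rw [hd, hN (hyO μ hμ).1]
      ring
    · dsimp only
      rw [AddCircle.coe_add_period]
    · dsimp only
      rw [AddCircle.coe_neg, he]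
  · have h := toL2Per_ae_real (y μ)
    rw [(hsol μ hμ).2.1] at h
    filter_upwards [h] with x hx
    rw [sobolevMap_zero, hx, ← (hsol μ hμ).2.1]
  · funext x
    dsimp only
    rw [hyμ, hy₀]
  · exact (continuous_subtype_val.tendsto _).comp
      (hΨ.continuousOn.continuousAt (hO.mem_nhds hμO)).tendsto
  · rw [Metric.tendstoUniformlyOn_iff]
    intro ε hε
    have := hyk.continuousOn.continuousAt (hO.mem_nhds hμO)
    filter_upwards [Metric.continuousAt_iff'.1 this ε hε] with μ hμ x _
    rw [← hy₀, ← hyμ, dist_comm]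
    exact (ContinuousMap.dist_apply_le_dist _).trans_lt hμ

end Reduction

end PeriodicWave

theorem mainTheorem7 (n : ℕ) (P : Set (EuclideanSpace ℝ (Fin n))) (hP : IsOpen P)
    (g : EuclideanSpace ℝ (Fin n) → ℝ → ℝ)
    (k : ℕ∞) (hk : 1 ≤ k)
    (L₀ : ℝ) [Fact (0 < L₀)]
    (μ₀ : EuclideanSpace ℝ (Fin n)) (hμ₀ : μ₀ ∈ P)
    (φ₀ : ℝ → ℝ) (hφ₀ : PeriodicWave.IsEvenPeriodicSolution g L₀ μ₀ φ₀)
    (U : Set (EuclideanSpace ℝ (Fin n) × ℝ)) (hU : IsOpen U) (hUP : U ⊆ P ×ˢ Set.univ)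
    (hφU : ∀ x, (μ₀, φ₀ x) ∈ U)
    (hg : ContDiffOn ℝ (k : WithTop ℕ∞) (fun p => g p.1 p.2) U)
    (hker : PeriodicWave.hillKernel L₀ (fun x => deriv (g μ₀) (φ₀ x))
      = {y | ∃ c : ℝ, PeriodicWave.Represents y (fun x => c * deriv φ₀ x)}) :
    ∃ O : Set (EuclideanSpace ℝ (Fin n)), IsOpen O ∧ μ₀ ∈ O ∧ O ⊆ P ∧
      ∃ (ψ : EuclideanSpace ℝ (Fin n) → ℝ → ℝ)
        (Ψ : EuclideanSpace ℝ (Fin n) → PeriodicWave.H2PerEven L₀),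
        (∀ μ ∈ O, PeriodicWave.IsEvenPeriodicSolution g L₀ μ (ψ μ)) ∧
        (∀ μ ∈ O, PeriodicWave.Represents (Ψ μ : PeriodicWave.H2Per L₀) (ψ μ)) ∧
        ContDiffOn ℝ (k : WithTop ℕ∞) Ψ O ∧
        ψ μ₀ = φ₀ ∧
        Tendsto (fun μ => (Ψ μ : PeriodicWave.H2Per L₀)) (𝓝 μ₀)
          (𝓝 (Ψ μ₀ : PeriodicWave.H2Per L₀)) ∧
        TendstoUniformlyOn ψ φ₀ (𝓝 μ₀) (Set.Icc 0 L₀) := by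
  exact PeriodicWave.exists_even_periodic_branch hk hφ₀ hU hUP hφU hg hker
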